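/- Let $d\ge 1$, $r\ge 1$, let $S=\{s_1<\dots<s_{r-1}\}$ be a finite totally ordered set of labels disjoint from $\{0,1,\dots,d\}$, put $s_0=0$ and $[d]=\{1,\dots,d\}$, and let $e_1,\dots,e_{r-1}\ge 2$ be integers with $\sum_{j=1}^{r-1}(e_j-1)=d-1$. A factorization of $(1\,2\,\cdots\,d)$ of type $(e_1,\dots,e_{r-1})$ is a tuple $(\sigma_1,\dots,\sigma_{r-1})$ of permutations of $[d]$ such that each $\sigma_j$ is an $e_j$-cycle and $\sigma_1\cdots\sigma_{r-1}=(1\,2\,\cdots\,d)$. Its factorization graph is the bipartite graph on the vertex set $S\cup[d]$ with edges $\{s_j,\nu\}$ for $\nu\in\operatorname{supp}(\sigma_j)$. Let $\mathcal G^*$ be the set of all factorization graphs of factorizations of $(1\,2\,\cdots\,d)$ of type $(e_1,\dots,e_{r-1})$. For positive integers $f_0,\dots,f_{r-1}$, a multi-noded rooted tree of vertex data $(f_0,\dots,f_{r-1})$ is a pair $M=(T,\beta)$, where $T$ is a tree on $S\cup\{0\}$ rooted at $0$ and $\beta$ assigns to each edge of $T$ whose parent end (the end closer to the root) is $s_i$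 an element of $\{1,\dots,f_i\}$. The vertex $s_i$ is thought of as containing $f_i$ nodes ordered from left to right, and an edge $\epsilon$ with parent end $s_i$ as attached to the $\beta(\epsilon)$-th node of $s_i$. A node labeling of $M$ is a bijection from the set of its $f_0+\dots+f_{r-1}$ nodes to $[d]$. Let $\mathcal{MR}_S(f_0,\dots,f_{r-1})$ be the set of all multi-noded rooted trees of vertex data $(f_0,\dots,f_{r-1})$. Then every $G\in\mathcal G^*$ is a tree. Root $G$ at the vertex $1\in[d]$ and let $\Phi^{\mathcal L}(G)=(M,\mathfrak l)$ be the following multi-noded rooted tree with node labeling: the root $s_0$ contains a single node, labeled $1$; for $1\le i\le r-1$ the vertex $s_i$ contains $e_i-1$ nodes, labeled from left to right by the children of $s_i$ in $G$ in increasing order; and $s_i$ is connected to the node labeled by the parent of $s_i$ in $G$. Put $\Phi(G)=M$, that is, forget the node labels. Then $\Phi^{\mathcal L}(G)$ is indeed an element $M$ of $\mathcal{MR}_S(1,e_1-1,\dots,e_{r-1}-1)$ with a node labeling, and 1. $\Phi$ is a bijection from $\mathcal G^*$ onto $\mathcal{MR}_S(1,e_1-1,\dots,e_{r-1}-1)$;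 2. for every $M\in\mathcal{MR}_S(1,e_1-1,\dots,e_{r-1}-1)$ there is a unique node labeling $\mathfrak l$ of $M$ such that $(M,\mathfrak l)=\Phi^{\mathcal L}(G)$ for some $G\in\mathcal G^*$. -/

import Mathlib

/-!
Conventions. The label set `S = {s_1 < ⋯ < s_{r-1}}` is an arbitrary finite linearly ordered type,
so `r = |S| + 1`, and the integer `e_j` is written `e s_j` with `e : S → ℕ`.
The set `[d] = {1, …, d}` is `Fin d` with its usual order, the number `k` being written `k - 1`;
in particular `1 ∈ [d]` is `(0 : Fin d)` and the cycle `(1 2 ⋯ d)` is `finRotate d`.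
The disjoint union `S ∪ [d]` is `S ⊕ Fin d`, and `S ∪ {0}` is `Option S`, the root `s_0 = 0`
being `none`.
-/

namespace HurwitzTrees

variable {S : Type*} {d : ℕ}

/-- `σ = (σ_1, …, σ_{r-1})` is a factorization of `τ` of type `(e_1, …, e_{r-1})`: every `σ_j` is an
`e_j`-cycle and `σ_1 ⋯ σ_{r-1} = τ`, the factors being taken in the order of `S`. -/
structure IsFactorization [Fintype S] [LinearOrder S] (τ : Equiv.Perm (Fin d)) (e : S → ℕ)
    (σ : S → Equiv.Perm (Fin d)) : Prop where
  isCycle : ∀ j, (σ j).IsCycle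
  card_support : ∀ j, (σ j).support.card = e j
  prod_eq : ((Finset.univ.sort (fun a b : S => a ≤ b)).map σ).prod = τ

/-- The `S`-`[d]` bipartite graph associated to `σ`: its edges are the pairs `{s_j, ν}` with `ν` in
the support of `σ_j`. -/
def factorizationGraph (σ : S → Equiv.Perm (Fin d)) : SimpleGraph (S ⊕ Fin d) :=
  SimpleGraph.fromRel fun x y => ∃ j ν, x = Sum.inl j ∧ y = Sum.inr ν ∧ ν ∈ (σ j).support

/-- The set of all factorization graphs of type `(d, r, τ; e_1, …, e_{r-1})`. -/
def factorizationGraphs [Fintype S] [LinearOrder S] (τ : Equiv.Perm (Fin d)) (e : S → ℕ) :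
    Set (SimpleGraph (S ⊕ Fin d)) :=
  {G | ∃ σ : S → Equiv.Perm (Fin d), IsFactorization τ e σ ∧ factorizationGraph σ = G}

/-- A pair `(T, β)` of a graph on `V` and a labeling of its edges by natural numbers. To make `β` a
function on a fixed type it is defined on all unordered pairs; `IsMultiNodedRootedTree` below
requires the value `0` off the edges, so that `β` carries exactly the information of a function
on the edge set. -/
@[ext]
structure EdgeLabeledGraph (V : Type*) where
  graph : SimpleGraph V
  β : Sym2 V → ℕ

/-- `M = (T, β)` is a multi-noded rooted tree on `S ∪ {0}` of vertex data `f`: `T` is a tree on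
`S ∪ {0}`, rooted at `0`, and `β(e) ∈ {1, …, f_v}` for every edge `e` with parent end `v`
(the end closer to the root). -/
structure IsMultiNodedRootedTree (f : Option S → ℕ) (M : EdgeLabeledGraph (Option S)) : Prop where
  isTree : M.graph.IsTree
  β_mem : ∀ v w, M.graph.Adj v w → M.graph.dist none v < M.graph.dist none w →
    M.β s(v, w) ∈ Finset.Icc 1 (f v)
  β_eq_zero : ∀ z, z ∉ M.graph.edgeSet → M.β z = 0

/-- The set of all multi-noded rooted trees on `S ∪ {0}` of vertex data `f`. -/
def MR (f : Option S → ℕ) : Set (EdgeLabeledGraph (Option S)) :=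
  {M | IsMultiNodedRootedTree f M}

/-- The nodes of a multi-noded rooted tree of vertex data `f`: every vertex `v` contains `f_v`
ordered nodes. The `k`-th node of `v`, for `1 ≤ k ≤ f_v`, is `⟨v, k - 1⟩`. -/
abbrev Nodes (f : Option S → ℕ) : Type _ := (v : Option S) × Fin (f v)

/-- The set of labeled multi-noded rooted trees of vertex data `f`: pairs of a multi-noded rooted
tree of vertex data `f` and a bijection from its nodes to `[d]`. -/
def LMR (f : Option S → ℕ) (d : ℕ) : Set (EdgeLabeledGraph (Option S) × (Nodes f → Fin d)) :=
  {P | P.1 ∈ MR f ∧ Function.Bijective P.2}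

/-- The vertex data `(1, e_1 - 1, …, e_{r-1} - 1)`. -/
def vertexData (e : S → ℕ) (v : Option S) : ℕ := v.elim 1 fun j => e j - 1

section Phi

variable [NeZero d]

/-- In the graph `G` rooted at the `[d]`-vertex `1`, the vertex `ν` is the parent of `s_j`. -/
def IsParentOf (G : SimpleGraph (S ⊕ Fin d)) (ν : Fin d) (j : S) : Prop :=
  G.Adj (Sum.inr ν) (Sum.inl j) ∧
    G.dist (Sum.inr 0) (Sum.inr ν) < G.dist (Sum.inr 0) (Sum.inl j)

/-- In the graph `G` rooted at the `[d]`-vertex `1`, the vertex `ν` is a child of `s_j`. -/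
def IsChildOf (G : SimpleGraph (S ⊕ Fin d)) (ν : Fin d) (j : S) : Prop :=
  G.Adj (Sum.inr ν) (Sum.inl j) ∧
    G.dist (Sum.inr 0) (Sum.inl j) < G.dist (Sum.inr 0) (Sum.inr ν)

open Classical in
/-- The set of labels of the nodes that are put into the vertex `v`: the root `s_0` gets the single
node `1`, and `s_j` gets its children. -/
noncomputable def nodeLabels (G : SimpleGraph (S ⊕ Fin d)) : Option S → Finset (Fin d)
  | none => {0}
  | some j => Finset.univ.filter fun ν => IsChildOf G ν j

/-- The vertex `s_j` is connected to the node labeled `ν` of the vertex `v`. -/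
def IsAttached (G : SimpleGraph (S ⊕ Fin d)) (j : S) (v : Option S) (ν : Fin d) : Prop :=
  ν ∈ nodeLabels G v ∧ IsParentOf G ν j

open Classical in
/-- The map `Φ`. The vertex `s_j` is joined to the vertex containing its parent node `ν`, and the
edge is labeled by the position of `ν` among the nodes of that vertex, arranged in increasing
order, i.e. by the number of nodes `μ ≤ ν` of that vertex. -/
noncomputable def Phi (G : SimpleGraph (S ⊕ Fin d)) : EdgeLabeledGraph (Option S) where
  graph := SimpleGraph.fromRel fun v w => ∃ j ν, w = some j ∧ IsAttached G j v ν
  β z := (Finset.univ.filter fun μ : Fin d =>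
    ∃ j v ν, z = s(v, some j) ∧ IsAttached G j v ν ∧ μ ∈ nodeLabels G v ∧ μ ≤ ν).card

/-- The map `Φ^L`: the multi-noded rooted tree `Φ(G)` together with its node labels, which increase
from left to right in every vertex. (The default value `0` of `getD` is used only if some vertex
`v` does not get `f_v` nodes.) -/
noncomputable def PhiL (f : Option S → ℕ) (G : SimpleGraph (S ⊕ Fin d)) :
    EdgeLabeledGraph (Option S) × (Nodes f → Fin d) :=
  (Phi G, fun x => ((nodeLabels G x.1).sort (fun a b : Fin d => a ≤ b)).getD x.2 0)

end Phi

end HurwitzTrees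

/-! A factorization graph has `d + r - 1` vertices and `∑ e_j = d + r - 2` edges, and it is
connected because the product of the factors is transitive; hence it is a tree. Rooted at `1`, each
`s_j` has one parent and `e_j - 1` children, and every point of `[d]` other than `1` is a child of
exactly one `s_j`. So the children can serve as nodes, and `Φ` gives a multi-noded tree.

The graph alone does not say in which order `σ_j` visits its support. This order is forced
(`pow_apply_lt_pow_apply`): while the full cycle runs through `0, 1, …, d - 1`, each move that uses
`σ_j` advances one step along the cycle `σ_j`, and between two such moves the component left after
removing `s_j` does not change. Hence `σ_j` takes its parent point to its smallest child, then to
the next one, and so on. Thus `σ_j` is the transported `vertexCycle`, and the factorization is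
determined by the tree and its node labels.

Conversely, each multi-noded tree defines one cycle per vertex on its nodes. The supports form a
tree, so the product of these cycles is a single full cycle whatever the order of the factors
(`IsForest.sameCycle_prod`, `sameCycle_prod_vertexCycle`). Numbering the nodes along this cycle from
the root node turns the product into `finRotate d`, and no other numbering does so with the root at
`0`. This yields surjectivity (`exists_labeling`) as well as injectivity and uniqueness of labels
(`labeling_unique`).

Both sides are compared through the parent map `pn`: `Encodes` ties it to a multi-noded tree,
`IsPresentation` to a bipartite graph with labels. -/

namespace HurwitzTrees

/-! ### Distances and parents in rooted trees -/

section Graphs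

variable {V : Type*} {G : SimpleGraph V}

/-- A function that vanishes only at `r`, changes by at most one along edges and decreases along
some edge at every vertex but `r` is the distance from `r`. -/
theorem connected_and_dist_eq {r : V} {h : V → ℕ} (hr : h r = 0)
    (hadj : ∀ x y, G.Adj x y → h y ≤ h x + 1)
    (hdesc : ∀ x, x ≠ r → ∃ y, G.Adj y x ∧ h x = h y + 1) :
    G.Connected ∧ ∀ x, G.dist r x = h x := by
  have key : ∀ n x, h x = n → ∃ p : G.Walk r x, p.length = n := by
    intro n
    induction n with
    | zero =>
      intro x hx
      by_cases hxr : x = r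
      · subst hxr
        exact ⟨.nil, rfl⟩
      · obtain ⟨y, -, hy⟩ := hdesc x hxr
        omega
    | succ n ih =>
      intro x hx
      have hxr : x ≠ r := by rintro rfl; omega
      obtain ⟨y, hyx, hy⟩ := hdesc x hxr
      obtain ⟨p, hp⟩ := ih y (by omega)
      exact ⟨p.concat hyx, by simp [hp]⟩
  have low : ∀ x y (p : G.Walk x y), h y ≤ h x + p.length := by
    intro x y p
    induction p with
    | nil => simp
    | cons hxy p ih =>
      have := hadj _ _ hxy
      simp only [SimpleGraph.Walk.length_cons]
      omega
  have reach : ∀ x, G.Reachable r x := fun x => by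
    obtain ⟨p, -⟩ := key _ x rfl
    exact ⟨p⟩
  have : Nonempty V := ⟨r⟩
  refine ⟨⟨fun x y => (reach x).symm.trans (reach y)⟩, fun x => le_antisymm ?_ ?_⟩
  · obtain ⟨p, hp⟩ := key _ x rfl
    exact hp ▸ SimpleGraph.dist_le p
  · obtain ⟨p, hp⟩ := (reach x).exists_walk_length_eq_dist
    have := low _ _ p
    omega

theorem exists_adj_dist_lt (hG : G.Connected) {r w : V} (hw : w ≠ r) :
    ∃ v, G.Adj v w ∧ G.dist r v < G.dist r w := by
  obtain ⟨p, hp⟩ := hG.exists_walk_length_eq_dist r w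
  have hn : ¬ p.Nil := fun h => hw h.eq.symm
  refine ⟨p.penultimate, p.adj_penultimate hn, ?_⟩
  have h1 := SimpleGraph.dist_le p.dropLast
  have h2 : p.dropLast.length + 1 = p.length := by
    have := SimpleGraph.Walk.not_nil_iff_lt_length.1 hn
    simp only [SimpleGraph.Walk.length_dropLast]
    omega
  omega

/-- A shortest path to `v` cannot pass through a vertex farther from `r` than `v`. -/
theorem exists_isPath_notMem_support (hG : G.Connected) {r v w : V}
    (h : G.dist r v < G.dist r w) :
    ∃ p : G.Walk r v, p.IsPath ∧ w ∉ p.support := by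
  classical
  obtain ⟨p, hp, hl⟩ := hG.exists_path_of_dist r v
  refine ⟨p, hp, fun hw => ?_⟩
  have h1 := SimpleGraph.dist_le (p.takeUntil w hw)
  have h2 := p.length_takeUntil_le_length hw
  omega

/-- Uniqueness of the parent: a neighbour of `w` closer to `r` must be the penultimate vertex of the
path from `r` to `w`. -/
theorem eq_of_adj_of_dist_lt (hG : G.IsTree) {r v v' w : V} (hv : G.Adj v w)
    (hv' : G.Adj v' w) (h : G.dist r v < G.dist r w) (h' : G.dist r v' < G.dist r w) :
    v = v' := by
  obtain ⟨p, hp, -⟩ := hG.connected.exists_path_of_dist r w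
  have key : ∀ u, G.Adj u w → G.dist r u < G.dist r w → u = p.penultimate := by
    intro u hu hd
    obtain ⟨q, hq, hwq⟩ := exists_isPath_notMem_support hG.connected hd
    exact hG.isAcyclic.eq_penultimate_of_adj_end hp hu.symm
      (hG.isAcyclic.mem_support_of_ne_mem_support_of_adj_of_isPath hp hq hu.symm hwq)
  rw [key v hv h, key v' hv' h']

theorem dist_eq_succ_of_adj_of_lt (hG : G.IsTree) {r v w : V} (hv : G.Adj v w)
    (h : G.dist r v < G.dist r w) : G.dist r w = G.dist r v + 1 := by
  have := hG.dist_eq_dist_add_one_of_adj r hv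
  omega

end Graphs

/-! ### Products of cycles whose supports form a forest -/

section Supports

open Equiv.Perm

variable {S X : Type*} [Fintype X] [DecidableEq X]

/-- The equivalence relation on `X` generated by lying in the support of a common `σ j`, `j ∈ A`. -/
def Linked (σ : S → Equiv.Perm X) (A : Set S) : X → X → Prop :=
  Relation.EqvGen fun x y => ∃ j ∈ A, x ∈ (σ j).support ∧ y ∈ (σ j).support

/-- No two points of the support of `σ j` are linked through the supports of the other factors. -/
def IsForest (σ : S → Equiv.Perm X) : Prop :=
  ∀ j x y, x ∈ (σ j).support → y ∈ (σ j).support → Linked σ {j}ᶜ x y → x = y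

namespace Linked

variable {σ : S → Equiv.Perm X} {A B : Set S} {x y z : X}

theorem refl (x : X) : Linked σ A x x := Relation.EqvGen.refl x

theorem symm (h : Linked σ A x y) : Linked σ A y x := Relation.EqvGen.symm _ _ h

theorem trans (h : Linked σ A x y) (h' : Linked σ A y z) : Linked σ A x z :=
  Relation.EqvGen.trans _ _ _ h h'

theorem of_mem {j : S} (hj : j ∈ A) (hx : x ∈ (σ j).support) (hy : y ∈ (σ j).support) :
    Linked σ A x y := Relation.EqvGen.rel _ _ ⟨j, hj, hx, hy⟩

theorem mono (hAB : A ⊆ B) (h : Linked σ A x y) : Linked σ B x y :=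
  Relation.EqvGen.mono (fun _ _ ⟨j, hj, hxy⟩ => ⟨j, hAB hj, hxy⟩) _ _ h

theorem apply {j : S} (hj : j ∈ A) (x : X) : Linked σ A x (σ j x) := by
  by_cases hx : x ∈ (σ j).support
  · exact of_mem hj hx (apply_mem_support.2 hx)
  · rw [notMem_support.1 hx]
    exact refl x

theorem prod_apply (L : List S) (hL : ∀ j ∈ L, j ∈ A) (x : X) :
    Linked σ A x ((L.map σ).prod x) := by
  induction L with
  | nil => exact refl x
  | cons j L ih =>
    rw [List.map_cons, List.prod_cons, mul_apply]
    exact (ih fun i hi => hL i (by simp [hi])).trans (apply (hL j (by simp)) _)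

theorem pow_apply {P : Equiv.Perm X} (hP : ∀ x, Linked σ A x (P x)) (n : ℕ) (x : X) :
    Linked σ A x ((P ^ n) x) := by
  induction n with
  | zero => exact refl x
  | succ n ih =>
    rw [pow_succ', mul_apply]
    exact ih.trans (hP _)

end Linked

theorem exists_pow_eq_symm_apply {Y : Type*} [Finite Y] (P : Equiv.Perm Y) (x : Y) :
    ∃ n : ℕ, (P ^ n) (P x) = x := by
  have : SameCycle P (P x) x := sameCycle_apply_left.2 (SameCycle.refl P x)
  exact this.exists_nat_pow_eq

/-- If the supports of cycles form a forest, then every connected component of the forest is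
a cycle of the product. -/
theorem IsForest.sameCycle_prod {σ : S → Equiv.Perm X} (hF : IsForest σ)
    (hc : ∀ j, (σ j).IsCycle) (L : List S) (hL : L.Nodup) {x y : X}
    (hxy : Linked σ {j | j ∈ L} x y) : SameCycle (L.map σ).prod x y := by
  induction L generalizing x y with
  | nil =>
    induction hxy with
    | rel x y h => obtain ⟨j, hj, -⟩ := h; simp at hj
    | refl x => exact SameCycle.refl _ x
    | symm x y _ ih => exact ih.symm
    | trans x y z _ _ ih ih' => exact ih.trans ih'
  | cons j L ih =>
    rw [List.nodup_cons] at hL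
    specialize @ih hL.2
    rw [List.map_cons, List.prod_cons]
    set P := (L.map σ).prod with hP
    have hlink : ∀ z, Linked σ {j}ᶜ z (P z) := fun z =>
      Linked.prod_apply L (fun i hi => by rintro rfl; exact hL.1 hi) z
    -- The `P`-orbit of `v` stays linked to `v` without `j`, so by the forest condition it meets the
    -- support of `σ j` only at `v`. Everywhere else `σ j * P` moves exactly as `P` does.
    have around : ∀ v ∈ (σ j).support, ∀ m : ℕ, SameCycle (σ j * P) v ((P ^ m) v) := by
      intro v hv m
      induction m with
      | zero => exact SameCycle.refl _ _
      | succ m ihm =>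
        by_cases hm : (P ^ (m + 1)) v ∈ (σ j).support
        · rw [← hF j v _ hv hm (Linked.pow_apply hlink (m + 1) v)]
        · have : (σ j * P) ((P ^ m) v) = (P ^ (m + 1)) v := by
            rw [mul_apply, ← mul_apply P, ← pow_succ', notMem_support.1 hm]
          rw [← this]
          exact sameCycle_apply_right.2 ihm
    -- If `P z` lies in the support of `σ j`, the rest of the `P`-orbit leads from `P z` back to
    -- `z`.
    have step : ∀ z, SameCycle (σ j * P) z (P z) := by
      intro z
      by_cases hz : P z ∈ (σ j).support
      · obtain ⟨n, hn⟩ := exists_pow_eq_symm_apply P z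
        have := around _ hz n
        rw [hn] at this
        exact this.symm
      · have : (σ j * P) z = P z := by rw [mul_apply, notMem_support.1 hz]
        rw [← this]
        exact sameCycle_apply_right.2 (SameCycle.refl _ _)
    have steps : ∀ z w, SameCycle P z w → SameCycle (σ j * P) z w := by
      intro z w hzw
      obtain ⟨n, rfl⟩ := hzw.exists_nat_pow_eq
      induction n with
      | zero => exact SameCycle.refl _ _
      | succ n ihn =>
        rw [pow_succ', mul_apply]
        exact (ihn (sameCycle_pow_right.2 (SameCycle.refl _ _))).trans (step _)
    have jump : ∀ z, SameCycle (σ j * P) z (σ j z) := by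
      intro z
      have h1 : (σ j * P) (P⁻¹ z) = σ j z := by simp
      rw [← h1, sameCycle_apply_right]
      have := steps (P⁻¹ z) z (SameCycle.symm ⟨-1, by simp⟩)
      exact this.symm
    have jumps : ∀ z w, SameCycle (σ j) z w → SameCycle (σ j * P) z w := by
      intro z w hzw
      obtain ⟨n, rfl⟩ := hzw.exists_nat_pow_eq
      induction n with
      | zero => exact SameCycle.refl _ _
      | succ n ihn =>
        rw [pow_succ', mul_apply]
        exact (ihn (sameCycle_pow_right.2 (SameCycle.refl _ _))).trans (jump _)
    induction hxy with
    | rel x y h =>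
      obtain ⟨i, hi, hx, hy⟩ := h
      rcases List.mem_cons.1 hi with rfl | hi
      · exact jumps _ _ ((hc i).sameCycle (mem_support.1 hx) (mem_support.1 hy))
      · exact steps _ _ (ih (Linked.of_mem hi hx hy))
    | refl x => exact SameCycle.refl _ x
    | symm x y _ ih => exact ih.symm
    | trans x y z _ _ ih ih' => exact ih.trans ih'

/-- The bipartite graph joining `j` to the points of the support of `σ j`. -/
def supportGraph (σ : S → Equiv.Perm X) : SimpleGraph (S ⊕ X) :=
  SimpleGraph.fromRel fun x y => ∃ j v, x = Sum.inl j ∧ y = Sum.inr v ∧ v ∈ (σ j).support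

section SupportGraph

variable {σ : S → Equiv.Perm X}

@[simp]
theorem supportGraph_adj_inl_inr {j : S} {v : X} :
    (supportGraph σ).Adj (Sum.inl j) (Sum.inr v) ↔ v ∈ (σ j).support := by
  simp [supportGraph]

@[simp]
theorem supportGraph_adj_inr_inl {j : S} {v : X} :
    (supportGraph σ).Adj (Sum.inr v) (Sum.inl j) ↔ v ∈ (σ j).support := by
  simp [supportGraph]

@[simp]
theorem not_supportGraph_adj_inl_inl {i j : S} :
    ¬ (supportGraph σ).Adj (Sum.inl i) (Sum.inl j) := by
  simp [supportGraph]

@[simp]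
theorem not_supportGraph_adj_inr_inr {v w : X} :
    ¬ (supportGraph σ).Adj (Sum.inr v) (Sum.inr w) := by
  simp [supportGraph]

theorem Linked.exists_walk {A : Set S} {x y : X} (h : Linked σ A x y) :
    ∃ p : (supportGraph σ).Walk (Sum.inr x) (Sum.inr y), ∀ i, Sum.inl i ∈ p.support → i ∈ A := by
  induction h with
  | rel x y h =>
    obtain ⟨j, hj, hx, hy⟩ := h
    refine ⟨.cons (supportGraph_adj_inr_inl.2 hx) (.cons (supportGraph_adj_inl_inr.2 hy) .nil), ?_⟩
    intro i hi
    simp at hi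
    exact hi ▸ hj
  | refl x => exact ⟨.nil, by simp⟩
  | symm x y _ ih =>
    obtain ⟨p, hp⟩ := ih
    exact ⟨p.reverse, by simpa using hp⟩
  | trans x y z _ _ ih ih' =>
    obtain ⟨p, hp⟩ := ih
    obtain ⟨q, hq⟩ := ih'
    refine ⟨p.append q, fun i hi => ?_⟩
    rw [SimpleGraph.Walk.mem_support_append_iff] at hi
    exact hi.elim (hp i) (hq i)

theorem linked_of_walk {A : Set S} {x y : X}
    (p : (supportGraph σ).Walk (Sum.inr x) (Sum.inr y)) (hp : ∀ i, Sum.inl i ∈ p.support → i ∈ A) :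
    Linked σ A x y := by
  -- Induction on the walk needs endpoints of both kinds; `near` replaces an endpoint `j` by an
  -- arbitrary point of its support.
  let near : S ⊕ X → X → Prop := fun a z => a.elim (fun i => z ∈ (σ i).support) (fun w => w = z)
  have key : ∀ a b (q : (supportGraph σ).Walk a b), (∀ i, Sum.inl i ∈ q.support → i ∈ A) →
      ∀ z w, near a z → near b w → Linked σ A z w := by
    intro a b q
    induction q with
    | @nil a =>
      intro hq z w hz hw
      rcases a with i | v
      · exact Linked.of_mem (hq i (by simp)) hz hw
      · obtain rfl : v = z := hz
        obtain rfl : v = w := hw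
        exact Linked.refl _
    | @cons a b c hab q ih =>
      intro hq z w hz hw
      have ih' := ih fun i hi => hq i (by simp [hi])
      rcases a with i | v <;> rcases b with k | u
      · simp at hab
      · exact (Linked.of_mem (hq i (by simp)) hz (supportGraph_adj_inl_inr.1 hab)).trans
          (ih' u w rfl hw)
      · obtain rfl : v = z := hz
        exact ih' v w (supportGraph_adj_inr_inl.1 hab) hw
      · simp at hab
  exact key _ _ p hp x y rfl rfl

/-- A link from `x` to `y` avoiding `j` gives a path different from `x – j – y`, against uniqueness
of paths. -/
theorem isForest_of_isAcyclic (h : (supportGraph σ).IsAcyclic) : IsForest σ := by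
  classical
  intro j x y hx hy hxy
  by_contra hne
  obtain ⟨p, hp⟩ := hxy.exists_walk
  have hj : Sum.inl j ∉ p.bypass.support := fun hj => hp j (p.support_bypass_subset_support hj) rfl
  let q : (supportGraph σ).Walk (Sum.inr x) (Sum.inr y) :=
    .cons (supportGraph_adj_inr_inl.2 hx) (.cons (supportGraph_adj_inl_inr.2 hy) .nil)
  have hq : q.IsPath := by simp [q, hne]
  have := (h.subsingleton_path _ _).elim ⟨p.bypass, p.bypass_isPath⟩ ⟨q, hq⟩
  rw [Subtype.mk.injEq] at this
  rw [this] at hj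
  simp [q] at hj

/-- The edges are the pairs of a `j` and a point of its support, so `hcard` is the edge count of a
tree. -/
theorem isTree_supportGraph [Fintype S] (hconn : (supportGraph σ).Connected)
    (hcard : ∑ j, (σ j).support.card + 1 = Fintype.card S + Fintype.card X) :
    (supportGraph σ).IsTree := by
  rw [SimpleGraph.isTree_iff_connected_and_card]
  refine ⟨hconn, ?_⟩
  have hE : Nat.card (supportGraph σ).edgeSet = ∑ j, (σ j).support.card := by
    let F : (Σ j, (σ j).support) → (supportGraph σ).edgeSet := fun x =>
      ⟨s(Sum.inl x.1, Sum.inr x.2.1), supportGraph_adj_inl_inr.2 x.2.2⟩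
    have hF : Function.Bijective F := by
      constructor
      · rintro ⟨i, v, hv⟩ ⟨k, w, hw⟩ h
        have h' := Sym2.eq_iff.1 (Subtype.mk.inj h)
        simp only [Sum.inl.injEq, Sum.inr.injEq, reduceCtorEq, and_self, or_false] at h'
        obtain ⟨rfl, rfl⟩ := h'
        rfl
      · rintro ⟨z, hz⟩
        induction z using Sym2.ind with
        | _ a b =>
          rw [SimpleGraph.mem_edgeSet] at hz
          rcases a with i | v <;> rcases b with k | u
          · simp at hz
          · exact ⟨⟨i, u, supportGraph_adj_inl_inr.1 hz⟩, rfl⟩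
          · exact ⟨⟨k, v, supportGraph_adj_inr_inl.1 hz⟩, Subtype.ext Sym2.eq_swap⟩
          · simp at hz
    rw [← Nat.card_eq_of_bijective F hF, Nat.card_eq_fintype_card, Fintype.card_sigma]
    simp only [Fintype.card_coe]
  rw [hE, hcard, Nat.card_eq_fintype_card, Fintype.card_sum]

theorem supportGraph_connected [Nonempty X] (h : ∀ x y, Linked σ Set.univ x y)
    (hσ : ∀ j, (σ j).support.Nonempty) : (supportGraph σ).Connected := by
  have h1 : ∀ x y : X, (supportGraph σ).Reachable (Sum.inr x) (Sum.inr y) := fun x y => by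
    obtain ⟨p, -⟩ := (h x y).exists_walk
    exact ⟨p⟩
  obtain ⟨x₀⟩ := ‹Nonempty X›
  have h2 : ∀ a, (supportGraph σ).Reachable a (Sum.inr x₀) := by
    rintro (j | x)
    · obtain ⟨v, hv⟩ := hσ j
      exact (supportGraph_adj_inl_inr.2 hv).reachable.trans (h1 v x₀)
    · exact h1 x x₀
  have : Nonempty (S ⊕ X) := ⟨Sum.inr x₀⟩
  exact ⟨fun a b => (h2 a).trans (h2 b).symm⟩

end SupportGraph

/-- In a product of cycles whose supports form a forest and whose product is `finRotate d`, each
factor `σ j` runs through its support in increasing order, starting after the point `p` from which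
`0` is reached without using `σ j`. -/
theorem pow_apply_lt_pow_apply {d : ℕ} [NeZero d] {σ : S → Equiv.Perm (Fin d)}
    (hF : IsForest σ) (hc : ∀ j, (σ j).IsCycle) {L : List S} (hL : L.Nodup)
    (hprod : (L.map σ).prod = finRotate d) {j : S} (hj : j ∈ L) {p : Fin d}
    (hp : p ∈ (σ j).support) (h0 : Linked σ {j}ᶜ 0 p) {m n : ℕ} (hm : 1 ≤ m) (hmn : m < n)
    (hn : n < (σ j).support.card) : (σ j ^ m) p < (σ j ^ n) p := by
  classical
  obtain ⟨L₁, L₂, rfl⟩ := List.append_of_mem hj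
  rw [List.nodup_middle, List.nodup_cons, List.mem_append, not_or] at hL
  rw [List.map_append, List.map_cons, List.prod_append, List.prod_cons] at hprod
  set A := (L₁.map σ).prod
  set B := (L₂.map σ).prod
  have hA : ∀ z, Linked σ {j}ᶜ z (A z) := fun z =>
    Linked.prod_apply L₁ (fun i hi => by rintro rfl; exact hL.1.1 hi) z
  have hB : ∀ z, Linked σ {j}ᶜ z (B z) := fun z =>
    Linked.prod_apply L₂ (fun i hi => by rintro rfl; exact hL.1.2 hi) z
  -- The product is `A * σ j * B` and `B` acts first, so these are the moves `y ↦ y + 1` with `y <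
  -- t` in which `σ j` really moves a point.
  let jumps : ℕ → Finset (Fin d) := fun t =>
    Finset.univ.filter fun y => (y : ℕ) < t ∧ B y ∈ (σ j).support
  have hpow : ∀ k, (σ j ^ k) p ∈ (σ j).support := fun k => pow_apply_mem_support.2 hp
  -- With `j` removed, `t` lies in the component of the point reached from `p` after as many steps
  -- of `σ j` as there were jumps. At a jump the forest condition identifies `B x` with that point.
  have key : ∀ t (ht : t < d), Linked σ {j}ᶜ ⟨t, ht⟩ ((σ j ^ (jumps t).card) p) := by
    intro t
    induction t with
    | zero =>
      intro ht
      have : jumps 0 = ∅ := by simp [jumps]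
      rw [this]
      exact h0
    | succ t ih =>
      intro ht
      have ht' : t < d := by omega
      specialize ih ht'
      set x : Fin d := ⟨t, ht'⟩ with hx
      have hrot : finRotate d x = ⟨t + 1, ht⟩ := by
        obtain ⟨d', rfl⟩ : ∃ d', d = d' + 1 := ⟨d - 1, by omega⟩
        exact finRotate_of_lt (by omega)
      rw [← hrot, ← hprod, mul_apply, mul_apply]
      by_cases hBx : B x ∈ (σ j).support
      · have hcard : jumps (t + 1) = insert x (jumps t) := by
          ext y
          simp only [jumps, Finset.mem_insert, Finset.mem_filter, Finset.mem_univ, true_and]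
          constructor
          · rintro ⟨h1, h2⟩
            rcases Nat.lt_succ_iff_lt_or_eq.1 h1 with h | h
            · exact Or.inr ⟨h, h2⟩
            · exact Or.inl (Fin.ext h)
          · rintro (rfl | ⟨h1, h2⟩)
            · exact ⟨Nat.lt_succ_self _, hBx⟩
            · exact ⟨by omega, h2⟩
        have hnot : x ∉ jumps t := by simp [jumps, hx]
        rw [hcard, Finset.card_insert_of_notMem hnot, pow_succ', mul_apply,
          hF j _ _ hBx (hpow _) ((hB x).symm.trans ih)]
        exact (hA _).symm
      · have hcard : jumps (t + 1) = jumps t := by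
          ext y
          simp only [jumps, Finset.mem_filter, Finset.mem_univ, true_and]
          constructor
          · rintro ⟨h1, h2⟩
            rcases Nat.lt_succ_iff_lt_or_eq.1 h1 with h | h
            · exact ⟨h, h2⟩
            · obtain rfl : y = x := Fin.ext h
              exact absurd h2 hBx
          · rintro ⟨h1, h2⟩
            exact ⟨by omega, h2⟩
        rw [hcard, notMem_support.1 hBx]
        exact ((hA _).symm.trans (hB x).symm).trans ih
  have hle : ∀ t, (jumps t).card ≤ (σ j).support.card := by
    intro t
    refine Finset.card_le_card_of_injOn B (fun y hy => ?_) B.injective.injOn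
    simp only [jumps, Finset.coe_filter, Set.mem_ofPred_eq] at hy
    exact hy.2.2
  have hcyc : (σ j).IsCycleOn (σ j).support := by
    have := (hc j).isCycleOn
    convert this using 1
    ext
    simp
  -- By `key` and the forest condition the count is `k` modulo the length of the cycle, and by `hle`
  -- it is at most that length. Excluding `k = 0` matters: counts `0` and a full turn would be
  -- indistinguishable. As the count is monotone in `t`, the order of the points follows.
  have hcount : ∀ k, 1 ≤ k → k < (σ j).support.card → (jumps ((σ j ^ k) p)).card = k := by
    intro k hk hk'
    have h1 := hF j _ _ (hpow _) (hpow _) (key ((σ j ^ k) p) ((σ j ^ k) p).2)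
    have h2 := (hcyc.pow_apply_eq_pow_apply hp).1 h1
    have h3 := hle ((σ j ^ k) p)
    unfold Nat.ModEq at h2
    rw [Nat.mod_eq_of_lt hk'] at h2
    rcases h3.lt_or_eq with h | h
    · rw [Nat.mod_eq_of_lt h] at h2
      exact h2.symm
    · rw [h, Nat.mod_self] at h2
      omega
  by_contra! hlt
  have hsub : jumps ((σ j ^ n) p) ⊆ jumps ((σ j ^ m) p) := by
    intro y hy
    simp only [jumps, Finset.mem_filter, Finset.mem_univ, true_and] at hy ⊢
    exact ⟨hy.1.trans_le hlt, hy.2⟩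
  have := Finset.card_le_card hsub
  rw [hcount n (by omega) hn, hcount m hm (by omega)] at this
  omega

end Supports

/-! ### Multi-noded rooted trees as parent maps -/

section Encoding

variable {S : Type*} {f : Option S → ℕ}

/-- `pn` assigns to every non-root vertex its parent node, in such a way that iterated parents end
at the root; `h` is the depth function. -/
def IsRooted (pn : S → Nodes f) : Prop :=
  ∃ h : Option S → ℕ, h none = 0 ∧ ∀ j, h (some j) = h (pn j).1 + 1

/-- `M` is the multi-noded tree in which `j` is attached to the node `pn j`. -/
structure Encodes (M : EdgeLabeledGraph (Option S)) (pn : S → Nodes f) : Prop where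
  adj : ∀ v w, M.graph.Adj v w ↔
    (∃ j, v = (pn j).1 ∧ w = some j) ∨ ∃ j, w = (pn j).1 ∧ v = some j
  β_eq : ∀ j, M.β s((pn j).1, some j) = (pn j).2 + 1
  β_eq_zero : ∀ z, z ∉ M.graph.edgeSet → M.β z = 0

namespace Encodes

variable {M M' : EdgeLabeledGraph (Option S)} {pn pn' : S → Nodes f}

theorem adj_parent (hM : Encodes M pn) (j : S) : M.graph.Adj (pn j).1 (some j) :=
  (hM.adj _ _).2 (Or.inl ⟨j, rfl, rfl⟩)

theorem eq (hM : Encodes M pn) (hM' : Encodes M' pn) : M = M' := by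
  have hg : M.graph = M'.graph := by
    ext v w
    rw [hM.adj, hM'.adj]
  refine EdgeLabeledGraph.ext hg (funext fun z => ?_)
  by_cases hz : z ∈ M.graph.edgeSet
  · induction z using Sym2.ind with
    | _ v w =>
      rcases (hM.adj v w).1 hz with ⟨j, rfl, rfl⟩ | ⟨j, rfl, rfl⟩
      · rw [hM.β_eq, hM'.β_eq]
      · rw [Sym2.eq_swap, hM.β_eq, hM'.β_eq]
  · rw [hM.β_eq_zero z hz, hM'.β_eq_zero z (hg ▸ hz)]

theorem connected_and_dist_eq (hM : Encodes M pn) {h : Option S → ℕ} (h0 : h none = 0)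
    (hs : ∀ j, h (some j) = h (pn j).1 + 1) :
    M.graph.Connected ∧ ∀ v, M.graph.dist none v = h v := by
  refine HurwitzTrees.connected_and_dist_eq h0 (fun v w hvw => ?_) (fun v hv => ?_)
  · rcases (hM.adj v w).1 hvw with ⟨j, rfl, rfl⟩ | ⟨j, rfl, rfl⟩
    · exact (hs j).le
    · have := hs j
      omega
  · obtain ⟨j, rfl⟩ := Option.ne_none_iff_exists'.1 hv
    exact ⟨_, hM.adj_parent j, hs j⟩

/-- Both depth functions are the distance from the root in the same graph, so they agree and fix the
orientation of every edge; `β` then gives the position of the node. -/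
theorem injective (hM : Encodes M pn) (hpn : IsRooted pn) (hM' : Encodes M pn')
    (hpn' : IsRooted pn') : pn = pn' := by
  obtain ⟨h, h0, hs⟩ := hpn
  obtain ⟨h', h0', hs'⟩ := hpn'
  have hh : h = h' := by
    ext v
    rw [← (hM.connected_and_dist_eq h0 hs).2, (hM'.connected_and_dist_eq h0' hs').2]
  subst hh
  ext1 j
  have h1 : (pn j).1 = (pn' j).1 := by
    rcases (hM'.adj _ _).1 (hM.adj_parent j) with ⟨i, hi, hij⟩ | ⟨i, hi, hij⟩
    · rw [hi, Option.some_injective _ hij]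
    · have e1 := hs j
      have e2 := hs' i
      rw [hij] at e1
      rw [← hi] at e2
      omega
  have h2 : ((pn j).2 : ℕ) = (pn' j).2 := by
    rw [← Nat.add_right_cancel_iff (n := 1), ← hM.β_eq, ← hM'.β_eq, h1]
  exact Sigma.ext h1 (Fin.heq_ext_iff (congrArg f h1) |>.2 h2)

theorem mem_MR [Fintype S] (hM : Encodes M pn) (hpn : IsRooted pn) : M ∈ MR f := by
  obtain ⟨h, h0, hs⟩ := hpn
  obtain ⟨hconn, hdist⟩ := hM.connected_and_dist_eq h0 hs
  refine ⟨?_, fun v w hvw hlt => ?_, hM.β_eq_zero⟩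
  · rw [SimpleGraph.isTree_iff_connected_and_card]
    refine ⟨hconn, ?_⟩
    let F : S → M.graph.edgeSet := fun j => ⟨s((pn j).1, some j), hM.adj_parent j⟩
    have hF : Function.Bijective F := by
      constructor
      · intro i j hij
        rcases Sym2.eq_iff.1 (Subtype.mk.inj hij) with ⟨-, h2⟩ | ⟨h1, h2⟩
        · exact Option.some_injective _ h2
        · have e1 := hs i
          have e2 := hs j
          rw [h1] at e1
          rw [← h2] at e2
          omega
      · rintro ⟨z, hz⟩
        induction z using Sym2.ind with
        | _ v w =>
          rcases (hM.adj v w).1 hz with ⟨j, rfl, rfl⟩ | ⟨j, rfl, rfl⟩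
          · exact ⟨j, rfl⟩
          · exact ⟨j, Subtype.ext Sym2.eq_swap⟩
    rw [← Nat.card_eq_of_bijective F hF, Nat.card_eq_fintype_card, Nat.card_eq_fintype_card,
      Fintype.card_option]
  · rw [hdist, hdist] at hlt
    rcases (hM.adj v w).1 hvw with ⟨j, rfl, rfl⟩ | ⟨j, rfl, rfl⟩
    · rw [hM.β_eq, Finset.mem_Icc]
      have := (pn j).2.2
      omega
    · have := hs j
      omega

end Encodes

/-- The parent is the neighbour closer to the root. The node index is `β - 1`, since `β` counts from
`1` and `Fin` from `0`. -/
theorem exists_encodes {M : EdgeLabeledGraph (Option S)} (hM : M ∈ MR f) :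
    ∃ pn : S → Nodes f, IsRooted pn ∧ Encodes M pn := by
  obtain ⟨hT, hβ, hβ0⟩ := hM
  choose p hp hlt using fun j : S =>
    exists_adj_dist_lt hT.connected (r := none) (Option.some_ne_none j)
  have hmem := fun j => Finset.mem_Icc.1 (hβ _ _ (hp j) (hlt j))
  refine ⟨fun j => ⟨p j, M.β s(p j, some j) - 1, by have := hmem j; omega⟩,
    ⟨M.graph.dist none, by simp, fun j => dist_eq_succ_of_adj_of_lt hT (hp j) (hlt j)⟩,
    ⟨fun v w => ⟨fun hvw => ?_, ?_⟩, fun j => ?_, hβ0⟩⟩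
  · have key : ∀ v w, M.graph.Adj v w → M.graph.dist none v < M.graph.dist none w →
        ∃ j, v = p j ∧ w = some j := by
      intro v w hvw hlt'
      have hw : w ≠ none := by rintro rfl; simp at hlt'
      obtain ⟨j, rfl⟩ := Option.ne_none_iff_exists'.1 hw
      exact ⟨j, eq_of_adj_of_dist_lt hT hvw (hp j) hlt' (hlt j), rfl⟩
    rcases (hT.dist_ne_of_adj none hvw).lt_or_gt with h | h
    · exact Or.inl (key v w hvw h)
    · exact Or.inr (key w v hvw.symm h)
  · rintro (⟨j, rfl, rfl⟩ | ⟨j, rfl, rfl⟩)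
    · exact hp j
    · exact (hp j).symm
  · have := hmem j
    dsimp only
    omega

end Encoding

/-! ### Bipartite graphs presented by a parent map and node labels -/

section Presentation

variable {S : Type*} {f : Option S → ℕ} {d : ℕ} [NeZero d]

/-- `G` is the bipartite graph in which `j` is joined to the label of its parent node `pn j` and to
the labels of its own nodes, and labels increase from left to right in every vertex. -/
structure IsPresentation (G : SimpleGraph (S ⊕ Fin d)) (pn : S → Nodes f) (l : Nodes f ≃ Fin d) :
    Prop where
  rooted : IsRooted pn
  root : ∀ k, l ⟨none, k⟩ = 0
  strictMono : ∀ v, StrictMono fun k => l ⟨v, k⟩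
  adj_iff : ∀ v j, G.Adj (Sum.inr v) (Sum.inl j) ↔ v = l (pn j) ∨ ∃ k, v = l ⟨some j, k⟩
  not_adj_inl : ∀ i j, ¬ G.Adj (Sum.inl i) (Sum.inl j)
  not_adj_inr : ∀ v w, ¬ G.Adj (Sum.inr v) (Sum.inr w)

/-- One level of the multi-noded tree is two levels of the bipartite graph. Monotonicity of the
labels is not assumed, because `exists_labeling` uses these distances to prove it. -/
theorem connected_and_dist_eq_of_adj_iff (hf : f none = 1) {G : SimpleGraph (S ⊕ Fin d)}
    {pn : S → Nodes f} {l : Nodes f ≃ Fin d} {h : Option S → ℕ} (h0 : h none = 0)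
    (hs : ∀ j, h (some j) = h (pn j).1 + 1) (root : ∀ k, l ⟨none, k⟩ = 0)
    (adj_iff : ∀ v j, G.Adj (Sum.inr v) (Sum.inl j) ↔ v = l (pn j) ∨ ∃ k, v = l ⟨some j, k⟩)
    (not_adj_inl : ∀ i j, ¬ G.Adj (Sum.inl i) (Sum.inl j))
    (not_adj_inr : ∀ v w, ¬ G.Adj (Sum.inr v) (Sum.inr w)) :
    G.Connected ∧ (∀ x, G.dist (Sum.inr 0) (Sum.inr (l x)) = 2 * h x.1) ∧
      ∀ j, G.dist (Sum.inr 0) (Sum.inl j) = 2 * h (pn j).1 + 1 := by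
  let H : S ⊕ Fin d → ℕ := Sum.elim (fun j => 2 * h (pn j).1 + 1) (fun v => 2 * h (l.symm v).1)
  have hz : l.symm 0 = ⟨none, ⟨0, by omega⟩⟩ := by rw [Equiv.symm_apply_eq, root]
  have hl : ∀ x, H (Sum.inr (l x)) = 2 * h x.1 := fun x => by simp [H]
  have hj : ∀ j, H (Sum.inl j) = 2 * h (pn j).1 + 1 := fun j => rfl
  have hadj : ∀ x y, G.Adj x y → H y ≤ H x + 1 := by
    have key : ∀ v j, G.Adj (Sum.inr v) (Sum.inl j) →
        H (Sum.inl j) ≤ H (Sum.inr v) + 1 ∧ H (Sum.inr v) ≤ H (Sum.inl j) + 1 := by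
      intro v j hvj
      rcases (adj_iff v j).1 hvj with rfl | ⟨k, rfl⟩
      · rw [hl, hj]
        omega
      · rw [hl, hj, hs]
        omega
    rintro (i | v) (j | w) hxy
    · exact absurd hxy (not_adj_inl _ _)
    · exact (key w i hxy.symm).2
    · exact (key v j hxy).1
    · exact absurd hxy (not_adj_inr _ _)
  have hdesc : ∀ x, x ≠ Sum.inr 0 → ∃ y, G.Adj y x ∧ H x = H y + 1 := by
    rintro (j | v) hx
    · exact ⟨Sum.inr (l (pn j)), (adj_iff _ _).2 (Or.inl rfl), by rw [hl, hj]⟩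
    · obtain ⟨⟨v, k⟩, rfl⟩ := l.surjective v
      rcases v with - | j
      · rw [root] at hx
        exact absurd rfl hx
      · exact ⟨Sum.inl j, ((adj_iff _ _).2 (Or.inr ⟨k, rfl⟩)).symm, by rw [hl, hj, hs]; ring⟩
  obtain ⟨hconn, hdist⟩ := connected_and_dist_eq (by simp [H, hz, h0]) hadj hdesc
  exact ⟨hconn, fun x => by rw [hdist, hl], fun j => by rw [hdist, hj]⟩

namespace IsPresentation

variable {G : SimpleGraph (S ⊕ Fin d)} {pn : S → Nodes f} {l : Nodes f ≃ Fin d}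

theorem isParentOf_and_isChildOf (hG : IsPresentation G pn l) (hf : f none = 1) (v : Fin d)
    (j : S) : (IsParentOf G v j ↔ v = l (pn j)) ∧ (IsChildOf G v j ↔ ∃ k, v = l ⟨some j, k⟩) := by
  obtain ⟨h, h0, hs⟩ := hG.rooted
  obtain ⟨-, hl, hj⟩ := connected_and_dist_eq_of_adj_iff hf h0 hs hG.root hG.adj_iff
    hG.not_adj_inl hG.not_adj_inr
  unfold IsParentOf IsChildOf
  rw [hG.adj_iff]
  refine ⟨⟨?_, ?_⟩, ⟨?_, ?_⟩⟩
  · rintro ⟨rfl | ⟨k, rfl⟩, hlt⟩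
    · rfl
    · rw [hl, hj, hs] at hlt
      omega
  · rintro rfl
    refine ⟨Or.inl rfl, ?_⟩
    rw [hl, hj]
    omega
  · rintro ⟨rfl | ⟨k, rfl⟩, hlt⟩
    · rw [hl, hj] at hlt
      omega
    · exact ⟨k, rfl⟩
  · rintro ⟨k, rfl⟩
    refine ⟨Or.inr ⟨k, rfl⟩, ?_⟩
    rw [hl, hj, hs]
    omega

theorem mem_nodeLabels (hG : IsPresentation G pn l) (hf : f none = 1) (v : Option S) (x : Fin d) :
    x ∈ nodeLabels G v ↔ ∃ k, x = l ⟨v, k⟩ := by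
  classical
  rcases v with - | j
  · rw [nodeLabels, Finset.mem_singleton]
    exact ⟨fun h => ⟨⟨0, by omega⟩, by rw [h, hG.root]⟩, fun ⟨k, hk⟩ => hk.trans (hG.root k)⟩
  · rw [nodeLabels, Finset.mem_filter, (hG.isParentOf_and_isChildOf hf x j).2]
    simp

theorem isAttached_iff (hG : IsPresentation G pn l) (hf : f none = 1) (j : S) (v : Option S)
    (x : Fin d) : IsAttached G j v x ↔ v = (pn j).1 ∧ x = l (pn j) := by
  rw [IsAttached, hG.mem_nodeLabels hf, (hG.isParentOf_and_isChildOf hf x j).1]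
  constructor
  · rintro ⟨⟨k, rfl⟩, h⟩
    exact ⟨congrArg Sigma.fst (l.injective h), h⟩
  · rintro ⟨rfl, rfl⟩
    exact ⟨⟨(pn j).2, rfl⟩, rfl⟩

theorem encodes_Phi (hG : IsPresentation G pn l) (hf : f none = 1) : Encodes (Phi G) pn := by
  classical
  have hne : ∀ j, (pn j).1 ≠ some j := by
    obtain ⟨h, h0, hs⟩ := hG.rooted
    intro j hj
    have := hs j
    rw [hj] at this
    omega
  have hadj : ∀ v w, (Phi G).graph.Adj v w ↔
      (∃ j, v = (pn j).1 ∧ w = some j) ∨ ∃ j, w = (pn j).1 ∧ v = some j := by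
    intro v w
    simp only [Phi, SimpleGraph.fromRel_adj, hG.isAttached_iff hf]
    constructor
    · rintro ⟨-, ⟨j, x, rfl, rfl, -⟩ | ⟨j, x, rfl, rfl, -⟩⟩
      · exact Or.inl ⟨j, rfl, rfl⟩
      · exact Or.inr ⟨j, rfl, rfl⟩
    · rintro (⟨j, rfl, rfl⟩ | ⟨j, rfl, rfl⟩)
      · exact ⟨hne j, Or.inl ⟨j, _, rfl, rfl, rfl⟩⟩
      · exact ⟨(hne j).symm, Or.inr ⟨j, _, rfl, rfl, rfl⟩⟩
  refine ⟨hadj, fun j => ?_, fun z hz => ?_⟩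
  · have hβ : (Phi G).β s((pn j).1, some j) = (Finset.univ.filter fun y : Fin d => ∃ i v x,
        s((pn j).1, some j) = s(v, some i) ∧ IsAttached G i v x ∧ y ∈ nodeLabels G v ∧
          y ≤ x).card := by
      unfold Phi
      congr
    -- Labels increase inside a vertex, so the labels up to that of the `k`-th node belong to the
    -- nodes up to `k`. Depth rules out reading the edge in the opposite direction.
    have himg : (Finset.univ.filter fun y : Fin d => ∃ i v x,
        s((pn j).1, some j) = s(v, some i) ∧ IsAttached G i v x ∧ y ∈ nodeLabels G v ∧ y ≤ x) =
        (Finset.Iic (pn j).2).image fun k => l ⟨(pn j).1, k⟩ := by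
      ext y
      simp only [Finset.mem_filter, Finset.mem_univ, true_and, hG.isAttached_iff hf,
        hG.mem_nodeLabels hf, Finset.mem_image, Finset.mem_Iic]
      constructor
      · rintro ⟨i, v, x, hz, ⟨rfl, rfl⟩, ⟨k, rfl⟩, hle⟩
        obtain rfl : j = i := by
          rcases Sym2.eq_iff.1 hz with ⟨-, h2⟩ | ⟨h1, h2⟩
          · exact Option.some_injective _ h2
          · obtain ⟨h, h0, hs⟩ := hG.rooted
            have e1 := hs i
            have e2 := hs j
            rw [← h1] at e1
            rw [h2] at e2
            omega
        exact ⟨k, (hG.strictMono (pn j).1).le_iff_le.1 hle, rfl⟩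
      · rintro ⟨k, hk, rfl⟩
        exact ⟨j, _, _, rfl, ⟨rfl, rfl⟩, ⟨k, rfl⟩, (hG.strictMono (pn j).1).le_iff_le.2 hk⟩
    rw [hβ, himg, Finset.card_image_of_injective _ (hG.strictMono _).injective, Fin.card_Iic]
  · unfold Phi
    rw [Finset.card_eq_zero, Finset.filter_eq_empty_iff]
    rintro y - ⟨i, v, x, rfl, hatt, -⟩
    rw [hG.isAttached_iff hf] at hatt
    exact hz ((hadj _ _).2 (Or.inl ⟨i, hatt.1, rfl⟩))

/-- A finite set has only one increasing enumeration; its length is `f v`, so the default of `getD`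
is never used. -/
theorem PhiL_eq (hG : IsPresentation G pn l) (hf : f none = 1) : PhiL f G = (Phi G, ⇑l) := by
  classical
  refine Prod.ext rfl (funext fun ⟨v, k⟩ => ?_)
  have hlab : nodeLabels G v = Finset.univ.image fun k => l ⟨v, k⟩ := by
    ext x
    simp [hG.mem_nodeLabels hf, eq_comm]
  have hcard : (nodeLabels G v).card = f v := by
    rw [hlab, Finset.card_image_of_injective _ (hG.strictMono v).injective, Finset.card_fin]
  have huniq := Finset.orderEmbOfFin_unique hcard
    (fun k => (hG.mem_nodeLabels hf v _).2 ⟨k, rfl⟩) (hG.strictMono v)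
  have := congrFun huniq k
  rw [Finset.orderEmbOfFin_apply] at this
  dsimp only [PhiL] at this ⊢
  rw [this]
  exact (List.getElem_eq_getD _).symm

end IsPresentation

end Presentation

open Equiv.Perm

/-! ### Transport of permutations along a bijection -/

section PermCongr

variable {X Y : Type*}

theorem permCongr_pow_apply (l : X ≃ Y) (g : Equiv.Perm X) (n : ℕ) (x : X) :
    (l.permCongr g ^ n) (l x) = l ((g ^ n) x) := by
  induction n with
  | zero => rfl
  | succ n ih => rw [pow_succ', mul_apply, ih, pow_succ', mul_apply]; simp

theorem isCycle_permCongr [Finite X] (l : X ≃ Y) {g : Equiv.Perm X} (hg : g.IsCycle) :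
    (l.permCongr g).IsCycle := by
  obtain ⟨x, hx, h⟩ := hg
  refine ⟨l x, by simpa using hx, fun y hy => ?_⟩
  obtain ⟨z, rfl⟩ := l.surjective y
  obtain ⟨n, hn⟩ := (h (y := z) (by simpa using hy)).exists_nat_pow_eq
  exact ⟨n, by rw [zpow_natCast, permCongr_pow_apply, hn]⟩

variable [Fintype X] [DecidableEq X] [Fintype Y] [DecidableEq Y]

theorem mem_support_permCongr (l : X ≃ Y) (g : Equiv.Perm X) (x : X) :
    l x ∈ (l.permCongr g).support ↔ x ∈ g.support := by
  simp

theorem card_support_permCongr (l : X ≃ Y) (g : Equiv.Perm X) :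
    (l.permCongr g).support.card = g.support.card := by
  rw [← Finset.card_map l.toEmbedding (s := g.support)]
  congr 1
  ext y
  obtain ⟨x, rfl⟩ := l.surjective y
  rw [mem_support_permCongr]
  simp

omit [Fintype X] [DecidableEq X] [Fintype Y] [DecidableEq Y] in
theorem prod_map_permCongr {S : Type*} (l : X ≃ Y) (c : S → Equiv.Perm X) (L : List S) :
    (L.map fun j => l.permCongr (c j)).prod = l.permCongr (L.map c).prod := by
  have := map_list_prod l.permCongrHom (L.map c)
  rw [List.map_map] at this
  exact this.symm

end PermCongr

/-! ### Numbering the points of a full cycle -/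

section FullCycle

variable {X : Type*} {d : ℕ} [NeZero d]

theorem finRotate_mk {t : ℕ} (ht : t + 1 < d) :
    finRotate d ⟨t, by omega⟩ = ⟨t + 1, ht⟩ := by
  obtain ⟨d', rfl⟩ : ∃ d', d = d' + 1 := ⟨d - 1, by omega⟩
  exact finRotate_of_lt (by omega)

/-- A numbering that turns a permutation into the rotation is determined by its zero. -/
theorem eq_of_permCongr_eq_finRotate {g : Equiv.Perm X} {l l' : X ≃ Fin d}
    (hl : l.permCongr g = finRotate d) (hl' : l'.permCongr g = finRotate d)
    {x₀ : X} (h0 : l x₀ = 0) (h0' : l' x₀ = 0) : l = l' := by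
  have key : ∀ t (ht : t < d) x, l x = ⟨t, ht⟩ → l' x = ⟨t, ht⟩ := by
    intro t
    induction t with
    | zero =>
      intro ht x hx
      have : x = x₀ := l.injective (hx.trans h0.symm)
      rw [this, h0']
      rfl
    | succ t ih =>
      intro ht x hx
      have e1 : finRotate d (l (g.symm x)) = l x := by rw [← hl]; simp
      have e2 : finRotate d (l' (g.symm x)) = l' x := by rw [← hl']; simp
      rw [hx, ← finRotate_mk ht] at e1
      rw [← e2, ih _ _ ((finRotate d).injective e1), finRotate_mk]
  ext x : 1
  exact (key _ (l x).2 x rfl).symm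

/-- Each point gets as its number the time at which the orbit of `x₀` reaches it. -/
theorem exists_permCongr_eq_finRotate [Fintype X] (hX : Fintype.card X = d) {g : Equiv.Perm X}
    (hg : ∀ x y, SameCycle g x y) (x₀ : X) :
    ∃ l : X ≃ Fin d, l.permCongr g = finRotate d ∧ l x₀ = 0 := by
  have hcyc : g.IsCycleOn (Finset.univ : Finset X) := by
    refine ⟨by simp, fun x _ y _ => hg x y⟩
  let F : Fin d → X := fun i => (g ^ (i : ℕ)) x₀
  have hsurj : Function.Surjective F := by
    intro y
    obtain ⟨n, hn, rfl⟩ := hcyc.exists_pow_eq (Finset.mem_univ x₀) (Finset.mem_univ y)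
    exact ⟨⟨n, by rwa [Finset.card_univ, hX] at hn⟩, rfl⟩
  have hbij : Function.Bijective F :=
    (Fintype.bijective_iff_surjective_and_card F).2 ⟨hsurj, by simp [hX]⟩
  have hrot : ∀ i, F (finRotate d i) = g (F i) := by
    intro i
    by_cases hi : (i : ℕ) + 1 < d
    · have : finRotate d i = ⟨i + 1, hi⟩ := finRotate_mk hi
      rw [this]
      simp only [F]
      rw [pow_succ', mul_apply]
    · obtain ⟨d', rfl⟩ : ∃ d', d = d' + 1 := ⟨d - 1, by have := i.2; omega⟩
      obtain rfl : i = Fin.last d' := Fin.ext (by simp; omega)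
      rw [finRotate_last]
      have h1 := hcyc.pow_card_apply (Finset.mem_univ x₀)
      rw [Finset.card_univ, hX, pow_succ', mul_apply] at h1
      simpa [F] using h1.symm
  let l := (Equiv.ofBijective F hbij).symm
  refine ⟨l, Equiv.ext fun i => ?_, ?_⟩
  · rw [Equiv.permCongr_apply]
    exact (Equiv.symm_apply_eq _).2 (hrot i).symm
  · rw [Equiv.symm_apply_eq]
    simp [F]

end FullCycle

/-! ### The cycles attached to the vertices of a rooted tree -/

section VertexCycle

variable {S : Type*} [DecidableEq S] {f : Option S → ℕ}

/-- The cycle that runs through the parent node of `j` and then, from left to right, through the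
nodes of `j`. -/
def vertexCycle (pn : S → Nodes f) (j : S) : Equiv.Perm (Nodes f) :=
  (pn j :: List.ofFn fun k => (⟨some j, k⟩ : Nodes f)).formPerm

variable {pn : S → Nodes f}

omit [DecidableEq S] in
theorem IsRooted.fst_ne (hpn : IsRooted pn) (j : S) : (pn j).1 ≠ some j := by
  obtain ⟨h, h0, hs⟩ := hpn
  intro hj
  have := hs j
  rw [hj] at this
  omega

omit [DecidableEq S] in
theorem IsRooted.nodup (hpn : IsRooted pn) (j : S) :
    (pn j :: List.ofFn fun k => (⟨some j, k⟩ : Nodes f)).Nodup := by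
  rw [List.nodup_cons]
  constructor
  · rw [List.mem_ofFn]
    rintro ⟨k, hk⟩
    exact hpn.fst_ne j (congrArg Sigma.fst hk).symm
  · exact List.nodup_ofFn.2 fun a b h => by simpa using h

theorem isCycle_vertexCycle (hpn : IsRooted pn) {j : S} (hj : 1 ≤ f (some j)) :
    (vertexCycle pn j).IsCycle :=
  List.isCycle_formPerm (hpn.nodup j) (by simpa using hj)

theorem vertexCycle_pow_apply (hpn : IsRooted pn) (j : S) (k : Fin (f (some j))) :
    (vertexCycle pn j ^ ((k : ℕ) + 1)) (pn j) = ⟨some j, k⟩ := by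
  have := k.2
  have hmod : ((k : ℕ) + 1) % (f (some j) + 1) = k + 1 := Nat.mod_eq_of_lt (by omega)
  unfold vertexCycle
  rw [List.formPerm_pow_apply_head _ _ (hpn.nodup j)]
  simp [hmod]

variable [Fintype S]

theorem support_vertexCycle (hpn : IsRooted pn) {j : S} (hj : 1 ≤ f (some j)) :
    (vertexCycle pn j).support = (pn j :: List.ofFn fun k => (⟨some j, k⟩ : Nodes f)).toFinset := by
  refine List.support_formPerm_of_nodup _ (hpn.nodup j) fun x hx => ?_
  have := congrArg List.length hx
  simp only [List.length_cons, List.length_ofFn, List.length_nil] at this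
  omega

theorem mem_support_vertexCycle (hpn : IsRooted pn) {j : S} (hj : 1 ≤ f (some j)) (x : Nodes f) :
    x ∈ (vertexCycle pn j).support ↔ x = pn j ∨ ∃ k, x = ⟨some j, k⟩ := by
  rw [support_vertexCycle hpn hj, List.mem_toFinset, List.mem_cons, List.mem_ofFn]
  simp only [eq_comm]

theorem card_support_vertexCycle (hpn : IsRooted pn) {j : S} (hj : 1 ≤ f (some j)) :
    (vertexCycle pn j).support.card = f (some j) + 1 := by
  rw [support_vertexCycle hpn hj, List.toFinset_card_of_nodup (hpn.nodup j)]
  simp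

/-- A cycle is recovered from the list of its successive values at one point of its support. -/
theorem eq_vertexCycle (j : S) {g : Equiv.Perm (Nodes f)}
    (hg : g.IsCycle) (hcard : g.support.card = f (some j) + 1) (hmem : pn j ∈ g.support)
    (hpow : ∀ k : Fin (f (some j)), (g ^ ((k : ℕ) + 1)) (pn j) = ⟨some j, k⟩) :
    g = vertexCycle pn j := by
  have hc : g.cycleOf (pn j) = g := hg.cycleOf_eq (mem_support.1 hmem)
  have hlist : g.toList (pn j) = pn j :: List.ofFn fun k => (⟨some j, k⟩ : Nodes f) := by
    refine List.ext_getElem (by simp [length_toList, hc, hcard]) fun n h1 h2 => ?_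
    rw [getElem_toList]
    rcases n with - | n
    · rfl
    · simp only [List.length_cons, List.length_ofFn] at h2
      simpa using hpow ⟨n, by omega⟩
  rw [vertexCycle, ← hlist, formPerm_toList, hc]

/-- The cycles of a rooted tree multiply to a full cycle, whatever the order of the factors. -/
theorem sameCycle_prod_vertexCycle (hf : f none = 1) (hf1 : ∀ j, 1 ≤ f (some j))
    (hpn : IsRooted pn) {L : List S} (hL : L.Nodup) (hmem : ∀ j, j ∈ L) (x y : Nodes f) :
    SameCycle (L.map (vertexCycle pn)).prod x y := by
  -- Strong induction on depth: a node of `j` shares the support of the cycle of `j` with the parent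
  -- node `pn j`, which is one level higher.
  have hlink : ∀ n, ∀ x : Nodes f, hpn.choose x.1 = n →
      Linked (vertexCycle pn) Set.univ x ⟨none, ⟨0, by omega⟩⟩ := by
    have hs := hpn.choose_spec.2
    intro n
    induction n using Nat.strong_induction_on with
    | _ n ih =>
      rintro ⟨v, k⟩ hx
      rcases v with - | j
      · have : k = ⟨0, by omega⟩ := Fin.ext (by have := k.2; dsimp only; omega)
        rw [this]
        exact Linked.refl _
      · refine Linked.trans (Linked.of_mem (Set.mem_univ j)
          ((mem_support_vertexCycle hpn (hf1 j) _).2 (Or.inr ⟨k, rfl⟩))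
          ((mem_support_vertexCycle hpn (hf1 j) _).2 (Or.inl rfl))) (ih _ ?_ (pn j) rfl)
        have := hs j
        dsimp only at hx
        omega
  have hall : ∀ x y, Linked (vertexCycle pn) Set.univ x y := fun x y =>
    (hlink _ x rfl).trans (hlink _ y rfl).symm
  have : Nonempty (Nodes f) := ⟨x⟩
  have hT : (supportGraph (vertexCycle pn)).IsTree := by
    refine isTree_supportGraph (supportGraph_connected hall fun j => ⟨pn j,
      (mem_support_vertexCycle hpn (hf1 j) _).2 (Or.inl rfl)⟩) ?_
    simp only [card_support_vertexCycle hpn (hf1 _), Fintype.card_sigma, Fintype.card_fin,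
      Fintype.sum_option, hf, Finset.sum_add_distrib, Finset.sum_const, Finset.card_univ,
      smul_eq_mul]
    ring
  refine (isForest_of_isAcyclic hT.isAcyclic).sameCycle_prod
    (fun j => isCycle_vertexCycle hpn (hf1 j)) L hL ?_
  exact (hall x y).mono fun j _ => hmem j

end VertexCycle

/-! ### Factorizations and labeled rooted trees -/

section Factorizations

variable {S : Type*} [Fintype S] [LinearOrder S] {d : ℕ} [NeZero d] {e : S → ℕ}
  {f : Option S → ℕ}

omit [LinearOrder S] in
theorem card_Nodes (f : Option S → ℕ) :
    Fintype.card (Nodes f) = f none + ∑ j, f (some j) := by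
  simp [Fintype.card_sigma, Fintype.sum_option]

/-- The product links each `x` to `finRotate d x`, hence all points to one another; the type
supplies the edge count. -/
theorem IsFactorization.isTree {σ : S → Equiv.Perm (Fin d)}
    (hσ : IsFactorization (finRotate d) e σ) (he : ∑ j, e j + 1 = Fintype.card S + d) :
    (supportGraph σ).IsTree := by
  have hlink : ∀ x, Linked σ Set.univ x (finRotate d x) := by
    rw [← hσ.prod_eq]
    exact Linked.prod_apply _ (by simp)
  have h0 : ∀ t (ht : t < d), Linked σ Set.univ 0 ⟨t, ht⟩ := by
    intro t
    induction t with
    | zero => intro ht; exact Linked.refl _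
    | succ t ih =>
      intro ht
      rw [← finRotate_mk ht]
      exact (ih _).trans (hlink _)
  refine isTree_supportGraph (supportGraph_connected
    (fun x y => (h0 _ x.2).symm.trans (h0 _ y.2)) fun j => (hσ.isCycle j).nonempty_support) ?_
  simp only [hσ.card_support, Fintype.card_fin, he]

omit [Fintype S] [LinearOrder S] in
theorem linked_of_isParentOf {σ : S → Equiv.Perm (Fin d)} (hT : (supportGraph σ).IsTree)
    {p : Fin d} {j : S} (hp : IsParentOf (supportGraph σ) p j) : Linked σ {j}ᶜ 0 p := by
  obtain ⟨w, -, hw⟩ := exists_isPath_notMem_support hT.connected hp.2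
  exact linked_of_walk w fun i hi => by rintro rfl; exact hw hi

theorem IsFactorization.strictMono {σ : S → Equiv.Perm (Fin d)}
    (hσ : IsFactorization (finRotate d) e σ) (he : ∑ j, e j + 1 = Fintype.card S + d)
    {p : Fin d} {j : S} (hp : IsParentOf (supportGraph σ) p j) {n : ℕ} (hn : e j = n + 1) :
    StrictMono fun k : Fin n => (σ j ^ ((k : ℕ) + 1)) p := by
  intro a b hab
  have hT := hσ.isTree he
  refine pow_apply_lt_pow_apply (isForest_of_isAcyclic hT.isAcyclic) hσ.isCycle
    (Finset.sort_nodup _ _) hσ.prod_eq (by simp) (supportGraph_adj_inr_inl.1 hp.1)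
    (linked_of_isParentOf hT hp) (by omega) (Nat.succ_lt_succ hab) ?_
  rw [hσ.card_support, hn]
  exact Nat.succ_lt_succ b.2

/-- Every rooted tree is labeled by a factorization. -/
theorem exists_labeling (hf : f none = 1) (hf1 : ∀ j, 1 ≤ f (some j))
    (he : ∀ j, e j = f (some j) + 1) (hcard : Fintype.card (Nodes f) = d) {pn : S → Nodes f}
    (hpn : IsRooted pn) :
    ∃ l : Nodes f ≃ Fin d,
      IsFactorization (finRotate d) e (fun j => l.permCongr (vertexCycle pn j)) ∧
      IsPresentation (supportGraph fun j => l.permCongr (vertexCycle pn j)) pn l := by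
  obtain ⟨l, hl, h0⟩ := exists_permCongr_eq_finRotate hcard
    (sameCycle_prod_vertexCycle hf hf1 hpn (Finset.sort_nodup Finset.univ (fun a b : S => a ≤ b))
      (by simp)) ⟨none, ⟨0, by omega⟩⟩
  set σ : S → Equiv.Perm (Fin d) := fun j => l.permCongr (vertexCycle pn j) with hσdef
  have hσ : IsFactorization (finRotate d) e σ := by
    refine ⟨fun j => isCycle_permCongr l (isCycle_vertexCycle hpn (hf1 j)), fun j => ?_, ?_⟩
    · rw [hσdef, card_support_permCongr, card_support_vertexCycle hpn (hf1 j), he]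
    · rw [hσdef, prod_map_permCongr, hl]
  have hsum : ∑ j, e j + 1 = Fintype.card S + d := by
    rw [← hcard, card_Nodes, hf]
    simp only [he, Finset.sum_add_distrib, Finset.sum_const, Finset.card_univ, smul_eq_mul]
    ring
  have hroot : ∀ k, l ⟨none, k⟩ = 0 := by
    intro k
    have : k = ⟨0, by omega⟩ := Fin.ext (by have := k.2; dsimp only; omega)
    rw [this, h0]
  have hadj : ∀ v j, (supportGraph σ).Adj (Sum.inr v) (Sum.inl j) ↔
      v = l (pn j) ∨ ∃ k, v = l ⟨some j, k⟩ := by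
    intro v j
    obtain ⟨x, rfl⟩ := l.surjective v
    rw [supportGraph_adj_inr_inl, hσdef, mem_support_permCongr, mem_support_vertexCycle hpn (hf1 j)]
    simp only [l.injective.eq_iff]
  refine ⟨l, hσ, hpn, hroot, ?_, hadj, by simp, by simp⟩
  rintro (- | j)
  · intro a b hab
    have := a.2
    have := b.2
    have : (a : ℕ) < b := hab
    omega
  · obtain ⟨h, hh0, hs⟩ := hpn
    obtain ⟨-, hdl, hdj⟩ := connected_and_dist_eq_of_adj_iff hf hh0 hs hroot hadj
      (by simp) (by simp)
    have hp : IsParentOf (supportGraph σ) (l (pn j)) j :=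
      ⟨(hadj _ _).2 (Or.inl rfl), by rw [hdl, hdj]; omega⟩
    -- The `k`-th label is the value at the parent of a power of the transported cycle, so the
    -- forced order of a factorization makes the labels increase.
    convert hσ.strictMono hsum hp (he j) using 2 with k
    rw [hσdef, permCongr_pow_apply, vertexCycle_pow_apply ⟨h, hh0, hs⟩]

/-- Every factorization comes from a labeled rooted tree. -/
theorem IsFactorization.exists_isPresentation (hf : f none = 1)
    (he : ∀ j, e j = f (some j) + 1) (hcard : Fintype.card (Nodes f) = d)
    {σ : S → Equiv.Perm (Fin d)} (hσ : IsFactorization (finRotate d) e σ) :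
    ∃ (pn : S → Nodes f) (l : Nodes f ≃ Fin d), IsPresentation (supportGraph σ) pn l ∧
      σ = fun j => l.permCongr (vertexCycle pn j) := by
  classical
  have hsum : ∑ j, e j + 1 = Fintype.card S + d := by
    rw [← hcard, card_Nodes, hf]
    simp only [he, Finset.sum_add_distrib, Finset.sum_const, Finset.card_univ, smul_eq_mul]
    ring
  have hT := hσ.isTree hsum
  set G := supportGraph σ with hG
  have hpar : ∀ j, ∃ v, IsParentOf G v j := by
    intro j
    obtain ⟨i | v, hadj, hlt⟩ := exists_adj_dist_lt hT.connected (r := Sum.inr 0)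
      (w := Sum.inl j) (by simp)
    · simp [hG] at hadj
    · exact ⟨v, hadj, hlt⟩
  choose q hq using hpar
  have hqs : ∀ j, q j ∈ (σ j).support := fun j => supportGraph_adj_inr_inl.1 (hq j).1
  have hchild : ∀ v j, v ∈ nodeLabels G (some j) ↔ IsChildOf G v j := by
    intro v j
    simp [nodeLabels]
  have hlab : ∀ j, nodeLabels G (some j) = (σ j).support.erase (q j) := by
    intro j
    ext v
    rw [hchild, Finset.mem_erase, IsChildOf, hG, supportGraph_adj_inr_inl, ← hG]
    constructor
    · rintro ⟨hv, hlt⟩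
      refine ⟨?_, hv⟩
      rintro rfl
      exact hlt.not_gt (hq j).2
    · rintro ⟨hne, hv⟩
      have hadj : G.Adj (Sum.inr v) (Sum.inl j) := supportGraph_adj_inr_inl.2 hv
      refine ⟨hv, (hT.dist_ne_of_adj (Sum.inr 0) hadj).lt_or_gt.resolve_left fun hlt => hne ?_⟩
      exact Sum.inr_injective (eq_of_adj_of_dist_lt hT hadj (hq j).1 hlt (hq j).2)
  have hlabcard : ∀ v, (nodeLabels G v).card = f v := by
    rintro (- | j)
    · rw [hf]
      rfl
    · rw [hlab, Finset.card_erase_of_mem (hqs j), hσ.card_support, he, Nat.add_sub_cancel]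
  -- Surjectivity suffices for bijectivity, as both sides have `d` elements: a point other than `0`
  -- is a child of its parent, and `0` labels the root node.
  let F : Nodes f → Fin d := fun x => (nodeLabels G x.1).orderEmbOfFin (hlabcard x.1) x.2
  have hF : ∀ x, F x ∈ nodeLabels G x.1 := fun x => Finset.orderEmbOfFin_mem _ _ _
  have hrange : ∀ v, ∀ x ∈ nodeLabels G v, ∃ k, x = F ⟨v, k⟩ := by
    intro v x hx
    have : x ∈ Set.range ((nodeLabels G v).orderEmbOfFin (hlabcard v)) := by
      rw [Finset.range_orderEmbOfFin]
      exact hx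
    obtain ⟨k, hk⟩ := this
    exact ⟨k, hk.symm⟩
  have hsurj : Function.Surjective F := by
    intro x
    have : ∃ v, x ∈ nodeLabels G v := by
      by_cases hx : x = 0
      · exact ⟨none, by simp [nodeLabels, hx]⟩
      · obtain ⟨j | v, hadj, hlt⟩ := exists_adj_dist_lt hT.connected (r := Sum.inr 0)
          (w := Sum.inr x) (by simpa using hx)
        · exact ⟨some j, (hchild _ _).2 ⟨hadj.symm, hlt⟩⟩
        · simp [hG] at hadj
    obtain ⟨v, hv⟩ := this
    obtain ⟨k, hk⟩ := hrange v x hv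
    exact ⟨_, hk.symm⟩
  let l : Nodes f ≃ Fin d := Equiv.ofBijective F
    ((Fintype.bijective_iff_surjective_and_card F).2 ⟨hsurj, by simp [hcard]⟩)
  have hl : ∀ x, l x = F x := fun x => rfl
  let pn : S → Nodes f := fun j => l.symm (q j)
  have hlpn : ∀ j, l (pn j) = q j := fun j => l.apply_symm_apply _
  have hroot : ∀ k, l ⟨none, k⟩ = 0 := fun k => Finset.mem_singleton.1 (hF ⟨none, k⟩)
  have hrooted : IsRooted pn := by
    -- The vertices `s_j` sit at odd distances `1, 3, 5, …` from the root of `G`, which become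
    -- depths `1, 2, 3, …`.
    refine ⟨fun v => v.elim 0 fun j => (G.dist (Sum.inr 0) (Sum.inl j) + 1) / 2, rfl, fun j => ?_⟩
    have h1 := dist_eq_succ_of_adj_of_lt hT (hq j).1 (hq j).2
    have h2 := hlpn j
    rcases hx : pn j with ⟨v, k⟩
    rw [hx] at h2
    rcases v with - | i
    · rw [hroot] at h2
      rw [← h2, SimpleGraph.dist_self] at h1
      simp [h1]
    · have h3 := (hchild _ _).1 (hF ⟨some i, k⟩)
      rw [← hl, h2] at h3
      have h4 := dist_eq_succ_of_adj_of_lt hT h3.1.symm h3.2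
      simp only [Option.elim_some]
      omega
  refine ⟨pn, l, ⟨hrooted, hroot, fun v => ?_, fun v j => ?_, by simp [hG], by simp [hG]⟩,
    funext fun j => ?_⟩
  · exact ((nodeLabels G v).orderEmbOfFin (hlabcard v)).strictMono
  · have hmem : v ∈ (σ j).support ↔ v = q j ∨ v ∈ nodeLabels G (some j) := by
      rw [hlab, Finset.mem_erase]
      by_cases hv : v = q j
      · simp only [hv, hqs, true_or]
      · simp [hv]
    rw [hG, supportGraph_adj_inr_inl, hmem, hlpn]
    refine or_congr_right ⟨hrange _ _, ?_⟩
    rintro ⟨k, rfl⟩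
    exact hF ⟨some j, k⟩
  · have hpow : ∀ k : Fin (f (some j)), (σ j ^ ((k : ℕ) + 1)) (q j) = l ⟨some j, k⟩ := by
      have hcyc : (σ j).IsCycleOn (σ j).support := by
        convert (hσ.isCycle j).isCycleOn using 1
        ext
        simp
      refine congrFun (Finset.orderEmbOfFin_unique (hlabcard (some j)) (fun k => ?_)
        (hσ.strictMono hsum (hq j) (he j)))
      rw [hlab, Finset.mem_erase]
      refine ⟨fun h => ?_, pow_apply_mem_support.2 (hqs j)⟩
      rw [hcyc.pow_apply_eq (hqs j), hσ.card_support, he] at h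
      have := Nat.le_of_dvd (by omega) h
      have := k.2
      omega
    have key : l.symm.permCongr (σ j) = vertexCycle pn j := by
      refine eq_vertexCycle j (isCycle_permCongr _ (hσ.isCycle j)) ?_ ?_ fun k => ?_
      · rw [card_support_permCongr, hσ.card_support, he]
      · exact (mem_support_permCongr _ _ _).2 (hqs j)
      · rw [permCongr_pow_apply, hpow, Equiv.symm_apply_apply]
    rw [← key]
    ext x
    simp

/-- The labeling of a rooted tree that comes from a factorization is unique. -/
theorem labeling_unique (hf : f none = 1) {pn : S → Nodes f} {l l' : Nodes f ≃ Fin d}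
    (hl : IsFactorization (finRotate d) e fun j => l.permCongr (vertexCycle pn j))
    (hl' : IsFactorization (finRotate d) e fun j => l'.permCongr (vertexCycle pn j))
    (h0 : ∀ k, l ⟨none, k⟩ = 0) (h0' : ∀ k, l' ⟨none, k⟩ = 0) : l = l' := by
  have h1 := hl.prod_eq
  have h2 := hl'.prod_eq
  rw [prod_map_permCongr] at h1 h2
  exact eq_of_permCongr_eq_finRotate h1 h2 (h0 ⟨0, by omega⟩) (h0' ⟨0, by omega⟩)

end Factorizations

end HurwitzTrees

/-! ### The bijection and the unique node labeling -/

/-- Let `e_j ≥ 2` and `∑ (e_j - 1) = d - 1`. Every factorization graph of `(1 2 ⋯ d)` is a tree, to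
which `Φ^L` assigns a labeled multi-noded rooted tree; forgetting the node labels, `Φ` is a bijection
from factorization graphs onto multi-noded rooted trees; and every multi-noded rooted tree
has a unique node labeling coming from a factorization graph. -/
theorem proposition5p1 {S : Type*} [Fintype S] [LinearOrder S] (d : ℕ) [NeZero d] (e : S → ℕ)
    (he : ∀ j, 2 ≤ e j) (hd : ∑ j, (e j - 1) = d - 1) :
    (∀ G ∈ HurwitzTrees.factorizationGraphs (finRotate d) e,
      G.IsTree ∧ HurwitzTrees.PhiL (HurwitzTrees.vertexData e) G ∈
        HurwitzTrees.LMR (HurwitzTrees.vertexData e) d) ∧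
    Set.BijOn HurwitzTrees.Phi
      (HurwitzTrees.factorizationGraphs (finRotate d) e)
      (HurwitzTrees.MR (HurwitzTrees.vertexData e)) ∧
    ∀ M ∈ HurwitzTrees.MR (HurwitzTrees.vertexData e),
      ∃! l : HurwitzTrees.Nodes (HurwitzTrees.vertexData e) → Fin d,
        ∃ G ∈ HurwitzTrees.factorizationGraphs (finRotate d) e,
          HurwitzTrees.PhiL (HurwitzTrees.vertexData e) G = (M, l) := by
  open HurwitzTrees in
  have hd0 : d ≠ 0 := NeZero.ne d
  have hf : vertexData e none = 1 := rfl
  have hfj : ∀ j, vertexData e (some j) = e j - 1 := fun j => rfl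
  have hf1 : ∀ j, 1 ≤ vertexData e (some j) := fun j => by have := he j; rw [hfj]; omega
  have hef : ∀ j, e j = vertexData e (some j) + 1 := fun j => by have := he j; rw [hfj]; omega
  have hcard : Fintype.card (Nodes (vertexData e)) = d := by
    rw [card_Nodes, hf]
    simp only [hfj, hd]
    omega
  have hsum : ∑ j, e j + 1 = Fintype.card S + d := by
    rw [← hcard, card_Nodes, hf, Finset.sum_congr rfl fun j _ => hef j]
    simp only [Finset.sum_add_distrib, Finset.sum_const, Finset.card_univ, smul_eq_mul]
    ring
  have hpres : ∀ G ∈ factorizationGraphs (finRotate d) e,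
      ∃ (pn : S → Nodes (vertexData e)) (l : Nodes (vertexData e) ≃ Fin d),
        IsPresentation G pn l ∧
        IsFactorization (finRotate d) e (fun j => l.permCongr (vertexCycle pn j)) ∧
        G = factorizationGraph fun j => l.permCongr (vertexCycle pn j) := by
    rintro _ ⟨σ, hσ, rfl⟩
    obtain ⟨pn, l, hP, hσl⟩ := hσ.exists_isPresentation hf hef hcard
    exact ⟨pn, l, hP, hσl ▸ hσ, congrArg factorizationGraph hσl⟩
  have hsurj : ∀ M ∈ MR (vertexData e), ∃ G ∈ factorizationGraphs (finRotate d) e,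
      ∃ l : Nodes (vertexData e) → Fin d, PhiL (vertexData e) G = (M, l) := by
    intro M hM
    obtain ⟨pn, hpn, henc⟩ := exists_encodes hM
    obtain ⟨l, hσ, hP⟩ := exists_labeling hf hf1 hef hcard hpn
    exact ⟨_, ⟨_, hσ, rfl⟩, l, (hP.PhiL_eq hf).trans
      (Prod.ext ((hP.encodes_Phi hf).eq henc) rfl)⟩
  have hinj : ∀ G ∈ factorizationGraphs (finRotate d) e,
      ∀ G' ∈ factorizationGraphs (finRotate d) e, Phi G = Phi G' → G = G' := by
    intro G hG G' hG' h
    obtain ⟨pn, l, hP, hσ, rfl⟩ := hpres G hG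
    obtain ⟨pn', l', hP', hσ', rfl⟩ := hpres G' hG'
    have henc := hP.encodes_Phi hf
    rw [h] at henc
    -- Equal images give equal parent maps, hence the same cycles on the nodes; only the numbering
    -- could differ, and it is unique.
    obtain rfl := henc.injective hP.rooted (hP'.encodes_Phi hf) hP'.rooted
    rw [labeling_unique hf hσ hσ' hP.root hP'.root]
  have hmem : ∀ G ∈ factorizationGraphs (finRotate d) e,
      PhiL (vertexData e) G ∈ LMR (vertexData e) d := by
    intro G hG
    obtain ⟨pn, l, hP, -, -⟩ := hpres G hG
    rw [hP.PhiL_eq hf]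
    exact ⟨(hP.encodes_Phi hf).mem_MR hP.rooted, l.bijective⟩
  refine ⟨fun G hG => ⟨?_, hmem G hG⟩, ⟨fun G hG => (hmem G hG).1,
    fun G hG G' hG' => hinj G hG G' hG', fun M hM => ?_⟩, fun M hM => ?_⟩
  · obtain ⟨σ, hσ, rfl⟩ := hG
    -- `factorizationGraph σ` and `supportGraph σ` agree by definition.
    exact hσ.isTree hsum
  · obtain ⟨G, hG, l, hl⟩ := hsurj M hM
    exact ⟨G, hG, congrArg Prod.fst hl⟩
  · obtain ⟨G, hG, l, hl⟩ := hsurj M hM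
    refine ⟨l, ⟨G, hG, hl⟩, ?_⟩
    rintro l' ⟨G', hG', hl'⟩
    -- Two labelings of `M` come from graphs with the same image under `Phi`, so injectivity of
    -- `Phi` identifies the graphs and with them the labelings.
    have : G = G' := hinj G hG G' hG'
      ((congrArg Prod.fst hl).trans (congrArg Prod.fst hl').symm)
    rw [← this, hl] at hl'
    exact (congrArg Prod.snd hl').symm
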